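/- Let $n\ge 0$ be an integer, $[n]=\{1,\dots,n\}$, and let $u,v\in\mathbb R^n$ be such that the factorizable matrix $\boldsymbol Q=\boldsymbol U\circ\boldsymbol V\in\mathbb R^{n\times n}$ (Hadamard product), where $U_{ij}=u_{\min\{i,j\}}$ and $V_{ij}=v_{\max\{i,j\}}$, is positive definite; thus $\boldsymbol Q$ is symmetric and $Q_{ij}=u_iv_j$ for $i\le j$. Let $$X_{\boldsymbol Q}=\left\{(\boldsymbol x,\boldsymbol z,\tau)\in\mathbb R^n\times\{0,1\}^n\times\mathbb R_+:\ \tau\ge \boldsymbol x^\top\boldsymbol Q\boldsymbol x,\ x_i(1-z_i)=0\ \text{ for } i\in[n]\right\}.$$ With $\boldsymbol e_i$ the standard basis vectors of $\mathbb R^n$, define $$\boldsymbol\Lambda_{i\to j}=\frac{u_j}{u_i(u_jv_i-u_iv_j)}\Big(\boldsymbol e_i-\frac{u_i}{u_j}\boldsymbol e_j\Big)\Big(\boldsymbol e_i-\frac{u_i}{u_j}\boldsymbol e_j\Big)^\top\ (1\le i<j\le n),\qquad \boldsymbol\Lambda_{i\to n+1}=\frac1{u_iv_i}\boldsymbol e_i\boldsymbol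 e_i^\top\ (1\le i\le n).$$ **Theorem.** The closed convex hull $\operatorname{cl}\operatorname{conv}(X_{\boldsymbol Q})$ is the set of all $(\boldsymbol x,\boldsymbol z,\tau)\in\mathbb R^n\times\mathbb R^n\times\mathbb R$ for which there exist $\boldsymbol W\in\mathbb R^{n\times n}$ and $\boldsymbol w=(w_{ij})_{0\le i<j\le n+1}\in\mathbb R_+^{(n+1)(n+2)/2}$ such that $$\begin{bmatrix}\boldsymbol W&\boldsymbol x\\ \boldsymbol x^\top&\tau\end{bmatrix}\succeq \boldsymbol 0$$ (the matrix is symmetric positive semidefinite) and $$\sum_{i=0}^{\ell-1}w_{i\ell}-\sum_{j=\ell+1}^{n+1}w_{\ell j}=\begin{cases}-1,&\ell=0,\\ 1,&\ell=n+1,\\ 0,&\text{otherwise,}\end{cases}\qquad \ell\in\{0,\dots,n+1\},$$ $$z_\ell=\sum_{i=0}^{\ell-1}w_{i\ell},\quad \ell\in[n],\qquad\text{and}\qquad \boldsymbol W=\sum_{i=1}^n\sum_{j=i+1}^{n+1}\boldsymbol\Lambda_{i\to j}\,w_{ij}.$$ -/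

import Mathlib

noncomputable section

namespace FactorizableHull

/-- The points `(x, z, τ)` of `ℝⁿ × ℝⁿ × ℝ = ℝ²ⁿ⁺¹`. -/
abbrev Point (n : ℕ) : Type := (Fin n → ℝ) × (Fin n → ℝ) × ℝ

/-- The symmetric matrix `U` with `U i j = u (min i j)`. -/
def matU {n : ℕ} (u : Fin n → ℝ) : Matrix (Fin n) (Fin n) ℝ :=
  Matrix.of fun i j => u (min i j)

/-- The symmetric matrix `V` with `V i j = v (max i j)`. -/
def matV {n : ℕ} (v : Fin n → ℝ) : Matrix (Fin n) (Fin n) ℝ :=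
  Matrix.of fun i j => v (max i j)

/-- The factorizable matrix `Q = U ∘ V` (Hadamard product) given by `u` and `v`. -/
def factorizable {n : ℕ} (u v : Fin n → ℝ) : Matrix (Fin n) (Fin n) ℝ :=
  Matrix.hadamard (matU u) (matV v)

/-- `Q i j = u i * v j` for `i ≤ j`. -/
theorem factorizable_apply_of_le {n : ℕ} (u v : Fin n → ℝ) {i j : Fin n} (h : i ≤ j) :
    factorizable u v i j = u i * v j := by
  simp [factorizable, matU, matV, h]

/-- `Q` is symmetric. -/
theorem factorizable_symm {n : ℕ} (u v : Fin n → ℝ) (i j : Fin n) :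
    factorizable u v i j = factorizable u v j i := by
  simp [factorizable, matU, matV, min_comm, max_comm]

/-- The mixed-integer epigraph `X_Q`: all `(x, z, τ) ∈ ℝⁿ × {0,1}ⁿ × ℝ₊` such that
`τ ≥ xᵀ Q x` and `x i * (1 - z i) = 0` for all `i`. -/
def epigraphSet {n : ℕ} (Q : Matrix (Fin n) (Fin n) ℝ) : Set (Point n) :=
  {p | (∀ i, p.2.1 i = 0 ∨ p.2.1 i = 1) ∧ 0 ≤ p.2.2 ∧
    p.1 ⬝ᵥ (Q.mulVec p.1) ≤ p.2.2 ∧ ∀ i, p.1 i * (1 - p.2.1 i) = 0}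

/-- The arcs `(i, j)`, `0 ≤ i < j ≤ n + 1`, of the acyclic digraph on the nodes `0, …, n + 1`. -/
abbrev Arc (n : ℕ) : Type := {a : Fin (n + 2) × Fin (n + 2) // a.1 < a.2}

/-- There are `(n + 1)(n + 2) / 2` arcs. -/
theorem card_arc (n : ℕ) : Fintype.card (Arc n) = (n + 1) * (n + 2) / 2 := by
  have h1 : Fintype.card (Arc n) = ∑ j : Fin (n + 2), (j : ℕ) := by
    rw [Fintype.card_subtype, Finset.card_filter, Fintype.sum_prod_type_right]
    refine Finset.sum_congr rfl fun j _ => ?_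
    rw [← Finset.card_filter]
    have : (Finset.univ.filter fun x : Fin (n + 2) => x < j) = Finset.Iio j := by
      ext x; simp
    rw [this, Fin.card_Iio]
  rw [h1, Fin.sum_univ_eq_sum_range (fun i => i), Finset.sum_range_id, mul_comm]
  simp

/-- The node `i ∈ {1, …, n}` that belongs to an index: as `Fin n` starts at `0`, this is the
shift by one. -/
def node {n : ℕ} (i : Fin n) : Fin (n + 2) := i.succ.castSucc

/-- The arc `(i, j)` between the nodes of two indices `i < j`. -/
def arcTo {n : ℕ} (i j : Fin n) (h : i < j) : Arc n :=
  ⟨(node i, node j), by simpa [node] using h⟩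

/-- The arc `(i, n + 1)` from the node of an index to the final node. -/
def arcEnd {n : ℕ} (i : Fin n) : Arc n :=
  ⟨(node i, Fin.last (n + 1)), by
    unfold node
    exact Fin.castSucc_lt_last i.succ⟩

/-- The total weight of the arcs that enter a node. -/
def inflow {n : ℕ} (w : Arc n → ℝ) (l : Fin (n + 2)) : ℝ :=
  ∑ a : Arc n with a.1.2 = l, w a

/-- The total weight of the arcs that leave a node. -/
def outflow {n : ℕ} (w : Arc n → ℝ) (l : Fin (n + 2)) : ℝ :=
  ∑ a : Arc n with a.1.1 = l, w a

/-- The vector `e_i - (u_i / u_j) e_j`. -/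
def arcVec {n : ℕ} (u : Fin n → ℝ) (i j : Fin n) : Fin n → ℝ :=
  Pi.single i 1 - (u i / u j) • Pi.single j 1

/-- `Λ_{i→j}` for indices `i < j`. -/
def lambdaTo {n : ℕ} (u v : Fin n → ℝ) (i j : Fin n) : Matrix (Fin n) (Fin n) ℝ :=
  (u j / (u i * (u j * v i - u i * v j))) • Matrix.vecMulVec (arcVec u i j) (arcVec u i j)

/-- `Λ_{i→n+1}`. -/
def lambdaEnd {n : ℕ} (u v : Fin n → ℝ) (i : Fin n) : Matrix (Fin n) (Fin n) ℝ :=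
  (1 / (u i * v i)) •
    Matrix.vecMulVec (Pi.single i (1 : ℝ) : Fin n → ℝ) (Pi.single i (1 : ℝ) : Fin n → ℝ)

/-- The path constraints on `(z, w, W)`: nonnegativity of `w`, flow balance for one unit from
node `0` to node `n + 1`, `z` as node inflows, and `W = ∑ Λ_{i→j} w_{ij}`, where the sum is over
`1 ≤ i ≤ n` and `i < j ≤ n + 1`. -/
structure PathConstraints {n : ℕ} (u v : Fin n → ℝ) (z : Fin n → ℝ) (w : Arc n → ℝ)
    (W : Matrix (Fin n) (Fin n) ℝ) : Prop where
  nonneg : ∀ a, 0 ≤ w a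
  balance : ∀ l : Fin (n + 2), inflow w l - outflow w l =
    if l = 0 then -1 else if l = Fin.last (n + 1) then 1 else 0
  node_inflow : ∀ i : Fin n, z i = inflow w (node i)
  decomp : W = ∑ i : Fin n,
    ((∑ j : {j : Fin n // i < j}, w (arcTo i j.1 j.2) • lambdaTo u v i j.1) +
      w (arcEnd i) • lambdaEnd u v i)

/-- The bordered matrix `[[W, x], [xᵀ, τ]]`. -/
def bordered {n : ℕ} (W : Matrix (Fin n) (Fin n) ℝ) (x : Fin n → ℝ) (τ : ℝ) :
    Matrix (Fin n ⊕ Unit) (Fin n ⊕ Unit) ℝ :=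
  Matrix.fromBlocks W (Matrix.replicateCol Unit x) (Matrix.replicateRow Unit x)
    (Matrix.of fun _ _ => τ)

end FactorizableHull

end

/-!
The paths from node `0` to node `n + 1` correspond to the supports `S ⊆ [n]`. For the path that
visits `S`, the sum `W_S` of the matrices `Λ_a` over its arcs is the inverse of the principal
submatrix `Q_S`, padded with zeros. To see this, put `f_i = e_i / u_i` for `i ∈ [n]`,
`f_{n+1} = 0`, and `r_i = v_i / u_i`, `r_{n+1} = 0`. Then `f_iᵀ Q f_j = r_{max(i,j)}`
(`nodeVec_gram`), so that `r` is strictly decreasing, and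
`Λ_{i→j} = (f_i - f_j) (f_i - f_j)ᵀ / (r_i - r_j)`. Hence `Λ_{i→j} Q f_m` is `f_i - f_j` for
`m ≤ i` and `0` for `m ≥ j`, and along a path through `m` the sum telescopes to `f_m`
(`IsPath.flowMatrix_mulVec_mulVec`).

A point of `X_Q` with support `S` therefore satisfies the path constraints with the incidence vector
of the path of `S`: if `W_S Q x = x`, the bordered form is a completed square
(`epigraphSet_subset_flowHull`). The set described by the constraints is convex, and it is closed
because the unit flows form a compact set.

Conversely, a unit flow `w` is a convex combination of paths (`mem_convexHull_of_balance`). The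
semidefinite constraint gives `x = W y` and `τ ≥ yᵀ W y` for some `y`
(`exists_mulVec_eq_of_bordered_nonneg`). The map `p ↦ (W_p y, z_p, yᵀ W_p y)` is linear in the
arc weights and sends every path to a point of `X_Q`, since `W_S Q W_S = W_S`; so
`(x, z, yᵀ W y)` is a convex combination of points of `X_Q`
(`flowHull_subset_convexHull`). In particular `conv X_Q` is already closed.
-/

namespace FactorizableHull

open Matrix

variable {n : ℕ}

/-! ### Node vectors and arc matrices -/

/-- The vector `f_l`: it is `e_k / u_k` at the node of an index `k`, and `0` at the nodes `0` and
`n + 1`. -/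
noncomputable def nodeVec (u : Fin n → ℝ) (l : Fin (n + 2)) : Fin n → ℝ :=
  fun k => if l = node k then (u k)⁻¹ else 0

/-- The ratio `r_l`: it is `v_k / u_k` at the node of an index `k`, and `0` at the nodes `0` and
`n + 1`. -/
noncomputable def ratio (u v : Fin n → ℝ) (l : Fin (n + 2)) : ℝ := nodeVec u l ⬝ᵥ v

/-- The matrix `Λ_a` of an arc `a`, in the form `(r_i - r_j)⁻¹ (f_i - f_j) (f_i - f_j)ᵀ` that covers
the arcs to the final node as well; arcs that leave node `0` carry the zero matrix. -/
noncomputable def arcMatrix (u v : Fin n → ℝ) (a : Arc n) : Matrix (Fin n) (Fin n) ℝ :=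
  if a.1.1 = 0 then 0 else
    (ratio u v a.1.1 - ratio u v a.1.2)⁻¹ •
      vecMulVec (nodeVec u a.1.1 - nodeVec u a.1.2) (nodeVec u a.1.1 - nodeVec u a.1.2)

/-- The matrix `∑ w_a Λ_a` as a linear function of the arc weights `w`. -/
noncomputable def flowMatrix (u v : Fin n → ℝ) : (Arc n → ℝ) →ₗ[ℝ] Matrix (Fin n) (Fin n) ℝ :=
  Fintype.linearCombination ℝ (arcMatrix u v)

theorem flowMatrix_apply (u v : Fin n → ℝ) (w : Arc n → ℝ) :
    flowMatrix u v w = ∑ a, w a • arcMatrix u v a :=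
  Fintype.linearCombination_apply ..

theorem flowMatrix_single (u v : Fin n → ℝ) (a : Arc n) :
    flowMatrix u v (Pi.single a 1) = arcMatrix u v a := by
  simp [flowMatrix, Fintype.linearCombination_apply_single]

theorem node_injective : Function.Injective (node : Fin n → Fin (n + 2)) :=
  (Fin.castSucc_injective _).comp (Fin.succ_injective _)

theorem node_le_node {i j : Fin n} : node i ≤ node j ↔ i ≤ j := by simp [node]

theorem node_lt_node {i j : Fin n} : node i < node j ↔ i < j := by simp [node]

theorem node_ne_zero (i : Fin n) : node i ≠ 0 := by
  simp [node, Fin.ext_iff]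

theorem node_ne_last (i : Fin n) : node i ≠ Fin.last (n + 1) :=
  (Fin.castSucc_lt_last i.succ).ne

theorem node_cases (l : Fin (n + 2)) : l = 0 ∨ l = Fin.last (n + 1) ∨ ∃ i : Fin n, l = node i := by
  induction l using Fin.lastCases with
  | last => exact Or.inr (Or.inl rfl)
  | cast l =>
    induction l using Fin.cases with
    | zero => exact Or.inl rfl
    | succ i => exact Or.inr (Or.inr ⟨i, rfl⟩)

theorem nodeVec_node (u : Fin n → ℝ) (i : Fin n) :
    nodeVec u (node i) = Pi.single i (u i)⁻¹ := by
  ext k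
  by_cases h : k = i
  · subst h; simp [nodeVec]
  · have : node i ≠ node k := fun e => h (node_injective e).symm
    simp [nodeVec, h, this]

theorem nodeVec_last (u : Fin n → ℝ) : nodeVec u (Fin.last (n + 1)) = 0 := by
  ext k
  simp [nodeVec, (node_ne_last k).symm]

theorem ratio_node (u v : Fin n → ℝ) (i : Fin n) : ratio u v (node i) = v i / u i := by
  rw [ratio, nodeVec_node, single_dotProduct, inv_mul_eq_div]

theorem ratio_last (u v : Fin n → ℝ) : ratio u v (Fin.last (n + 1)) = 0 := by
  rw [ratio, nodeVec_last, zero_dotProduct]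

theorem mul_pos_of_posDef {u v : Fin n → ℝ} (hQ : (factorizable u v).PosDef) (i : Fin n) :
    0 < u i * v i := by
  rw [← factorizable_apply_of_le u v le_rfl]
  exact hQ.diag_pos

theorem ne_zero_of_posDef {u v : Fin n → ℝ} (hQ : (factorizable u v).PosDef) (i : Fin n) :
    u i ≠ 0 := left_ne_zero_of_mul (mul_pos_of_posDef hQ i).ne'

/-- The Gram matrix of the node vectors with respect to `Q` depends only on the later node. -/
theorem nodeVec_gram {u v : Fin n → ℝ} (hu : ∀ i, u i ≠ 0) {l m : Fin (n + 2)}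
    (hl : l ≠ 0) (hm : m ≠ 0) :
    nodeVec u l ⬝ᵥ (factorizable u v *ᵥ nodeVec u m) = ratio u v (max l m) := by
  rcases node_cases l with h | rfl | ⟨i, rfl⟩
  · exact absurd h hl
  · rw [nodeVec_last, zero_dotProduct, max_eq_left (Fin.le_last _), ratio_last]
  rcases node_cases m with h | rfl | ⟨j, rfl⟩
  · exact absurd h hm
  · rw [nodeVec_last, mulVec_zero, dotProduct_zero, max_eq_right (Fin.le_last _), ratio_last]
  have hi := hu i
  have hj := hu j
  rw [nodeVec_node, nodeVec_node, single_dotProduct, mulVec_single]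
  simp only [Pi.smul_apply, MulOpposite.smul_eq_mul_unop, MulOpposite.unop_op, col_apply]
  rcases le_total i j with h | h
  · rw [max_eq_right (node_le_node.2 h), ratio_node, factorizable_apply_of_le u v h]
    field_simp
  · rw [max_eq_left (node_le_node.2 h), ratio_node, factorizable_symm,
      factorizable_apply_of_le u v h]
    field_simp

theorem nodeVec_sub_ne_zero {u : Fin n → ℝ} (hu : ∀ i, u i ≠ 0) {l m : Fin (n + 2)}
    (hl : l ≠ 0) (h : l < m) : nodeVec u l - nodeVec u m ≠ 0 := by
  intro e
  rcases node_cases l with h' | rfl | ⟨i, rfl⟩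
  · exact hl h'
  · exact absurd h (Fin.le_last _).not_gt
  · have := congrFun e i
    rw [Pi.sub_apply, nodeVec, nodeVec, if_pos rfl, if_neg h.ne'] at this
    simp [hu i] at this

/-- The ratios `v_i / u_i` decrease strictly from node `1` to node `n + 1`: their differences are
values of the quadratic form of `Q`. -/
theorem ratio_lt {u v : Fin n → ℝ} (hQ : (factorizable u v).PosDef) {l m : Fin (n + 2)}
    (hl : l ≠ 0) (h : l < m) : ratio u v m < ratio u v l := by
  have hu := ne_zero_of_posDef hQ
  have hm : m ≠ 0 := (Fin.zero_le l |>.trans_lt h).ne'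
  have := hQ.dotProduct_mulVec_pos (nodeVec_sub_ne_zero hu hl h)
  rw [star_trivial, mulVec_sub, dotProduct_sub, sub_dotProduct, sub_dotProduct,
    nodeVec_gram hu hl hl, nodeVec_gram hu hl hm, nodeVec_gram hu hm hl, nodeVec_gram hu hm hm,
    max_self, max_self, max_eq_right h.le, max_eq_left h.le] at this
  linarith

theorem arcMatrix_mulVec (u v y : Fin n → ℝ) {a : Arc n} (ha : a.1.1 ≠ 0) :
    arcMatrix u v a *ᵥ y =
      ((ratio u v a.1.1 - ratio u v a.1.2)⁻¹ *
        ((nodeVec u a.1.1 - nodeVec u a.1.2) ⬝ᵥ y)) • (nodeVec u a.1.1 - nodeVec u a.1.2) := by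
  rw [arcMatrix, if_neg ha, smul_mulVec, vecMulVec_mulVec, op_smul_eq_smul, smul_smul]

theorem arcMatrix_mulVec_of_zero (u v y : Fin n → ℝ) {a : Arc n} (ha : a.1.1 = 0) :
    arcMatrix u v a *ᵥ y = 0 := by
  rw [arcMatrix, if_pos ha, zero_mulVec]

theorem arcMatrix_mulVec_of_le {u v : Fin n → ℝ} (hQ : (factorizable u v).PosDef) {a : Arc n}
    {m : Fin (n + 2)} (hm : m ≠ 0) (h : m ≤ a.1.1) :
    arcMatrix u v a *ᵥ (factorizable u v *ᵥ nodeVec u m) =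
      nodeVec u a.1.1 - nodeVec u a.1.2 := by
  have hu := ne_zero_of_posDef hQ
  have h1 : a.1.1 ≠ 0 := ((Fin.pos_iff_ne_zero.2 hm).trans_le h).ne'
  have h2 : a.1.2 ≠ 0 := ((Fin.pos_iff_ne_zero.2 h1).trans a.2).ne'
  have h3 := ratio_lt hQ h1 a.2
  rw [arcMatrix_mulVec _ _ _ h1, sub_dotProduct, nodeVec_gram hu h1 hm, nodeVec_gram hu h2 hm,
    max_eq_left h, max_eq_left (h.trans a.2.le), inv_mul_cancel₀ (sub_pos.2 h3).ne', one_smul]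

theorem arcMatrix_mulVec_of_ge {u v : Fin n → ℝ} (hu : ∀ i, u i ≠ 0) {a : Arc n}
    {m : Fin (n + 2)} (h : a.1.2 ≤ m) :
    arcMatrix u v a *ᵥ (factorizable u v *ᵥ nodeVec u m) = 0 := by
  by_cases h1 : a.1.1 = 0
  · exact arcMatrix_mulVec_of_zero _ _ _ h1
  have h2 : a.1.2 ≠ 0 := ((Fin.pos_iff_ne_zero.2 h1).trans a.2).ne'
  have hm : m ≠ 0 := ((Fin.pos_iff_ne_zero.2 h2).trans_le h).ne'
  rw [arcMatrix_mulVec _ _ _ h1, sub_dotProduct, nodeVec_gram hu h1 hm, nodeVec_gram hu h2 hm,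
    max_eq_right h, max_eq_right (a.2.le.trans h), sub_self, mul_zero, zero_smul]

theorem arcMatrix_nonneg {u v : Fin n → ℝ} (hQ : (factorizable u v).PosDef) (a : Arc n)
    (y : Fin n → ℝ) : 0 ≤ y ⬝ᵥ (arcMatrix u v a *ᵥ y) := by
  by_cases h1 : a.1.1 = 0
  · rw [arcMatrix_mulVec_of_zero _ _ _ h1, dotProduct_zero]
  · have h3 := sub_pos.2 (ratio_lt hQ h1 a.2)
    rw [arcMatrix_mulVec _ _ _ h1, dotProduct_smul, smul_eq_mul, dotProduct_comm y, mul_assoc]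
    exact mul_nonneg (inv_nonneg.2 h3.le) (mul_self_nonneg _)

theorem arcMatrix_transpose (u v : Fin n → ℝ) (a : Arc n) :
    (arcMatrix u v a)ᵀ = arcMatrix u v a := by
  unfold arcMatrix
  split_ifs
  · simp
  · rw [transpose_smul, transpose_vecMulVec]

theorem flowMatrix_mulVec (u v : Fin n → ℝ) (w : Arc n → ℝ) (y : Fin n → ℝ) :
    flowMatrix u v w *ᵥ y = ∑ a, w a • (arcMatrix u v a *ᵥ y) := by
  rw [flowMatrix_apply, sum_mulVec]
  simp only [smul_mulVec]

theorem flowMatrix_nonneg {u v : Fin n → ℝ} (hQ : (factorizable u v).PosDef) {w : Arc n → ℝ}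
    (hw : ∀ a, 0 ≤ w a) (y : Fin n → ℝ) : 0 ≤ y ⬝ᵥ (flowMatrix u v w *ᵥ y) := by
  rw [flowMatrix_mulVec, dotProduct_sum]
  refine Finset.sum_nonneg fun a _ => ?_
  rw [dotProduct_smul]
  exact mul_nonneg (hw a) (arcMatrix_nonneg hQ a y)

theorem flowMatrix_transpose (u v : Fin n → ℝ) (w : Arc n → ℝ) :
    (flowMatrix u v w)ᵀ = flowMatrix u v w := by
  rw [flowMatrix_apply, transpose_sum]
  simp only [transpose_smul, arcMatrix_transpose]

theorem flowMatrix_mulVec_dotProduct (u v : Fin n → ℝ) (w : Arc n → ℝ) (y z : Fin n → ℝ) :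
    (flowMatrix u v w *ᵥ y) ⬝ᵥ z = y ⬝ᵥ (flowMatrix u v w *ᵥ z) := by
  rw [dotProduct_mulVec, ← mulVec_transpose, flowMatrix_transpose]

theorem arcMatrix_arcTo {u v : Fin n → ℝ} (hu : ∀ i, u i ≠ 0) (i j : Fin n) (h : i < j) :
    arcMatrix u v (arcTo i j h) = lambdaTo u v i j := by
  have hi := hu i
  have hj := hu j
  have hd : nodeVec u (node i) - nodeVec u (node j) = (u i)⁻¹ • arcVec u i j := by
    rw [nodeVec_node, nodeVec_node, arcVec, smul_sub, smul_smul, ← Pi.single_smul,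
      ← Pi.single_smul, smul_eq_mul, smul_eq_mul, mul_one, mul_one]
    congr 2
    field_simp
  have hr : (ratio u v (node i) - ratio u v (node j))⁻¹ * ((u i)⁻¹ * (u i)⁻¹) =
      u j / (u i * (u j * v i - u i * v j)) := by
    rw [ratio_node, ratio_node, div_sub_div _ _ hi hj, inv_div]
    rw [show v i * u j - u i * v j = u j * v i - u i * v j by ring, div_mul_eq_mul_div]
    rw [mul_comm (u i) (u j * v i - u i * v j), ← div_div, div_right_comm]
    congr 1
    field_simp
  rw [arcMatrix, if_neg (show (arcTo i j h).1.1 ≠ 0 from node_ne_zero i), lambdaTo, ← hr]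
  change _ • vecMulVec (nodeVec u (node i) - nodeVec u (node j))
    (nodeVec u (node i) - nodeVec u (node j)) = _
  rw [hd, smul_vecMulVec, vecMulVec_smul, smul_smul, smul_smul, mul_assoc]
  rfl

theorem arcMatrix_arcEnd {u v : Fin n → ℝ} (hu : ∀ i, u i ≠ 0) (i : Fin n) :
    arcMatrix u v (arcEnd i) = lambdaEnd u v i := by
  have hi := hu i
  have hd : nodeVec u (node i) - nodeVec u (Fin.last (n + 1)) =
      (u i)⁻¹ • (Pi.single i (1 : ℝ) : Fin n → ℝ) := by
    rw [nodeVec_node, nodeVec_last, sub_zero, ← Pi.single_smul, smul_eq_mul, mul_one]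
  have hr : (ratio u v (node i) - ratio u v (Fin.last (n + 1)))⁻¹ * ((u i)⁻¹ * (u i)⁻¹) =
      1 / (u i * v i) := by
    rw [ratio_node, ratio_last, sub_zero, inv_div, one_div, mul_inv]
    field_simp
  rw [arcMatrix, if_neg (show (arcEnd i).1.1 ≠ 0 from node_ne_zero i), lambdaEnd, ← hr]
  change _ • vecMulVec (nodeVec u (node i) - nodeVec u (Fin.last (n + 1)))
    (nodeVec u (node i) - nodeVec u (Fin.last (n + 1))) = _
  rw [hd, smul_vecMulVec, vecMulVec_smul, smul_smul, smul_smul, mul_assoc]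
  rfl

theorem sum_subtype_eq_sum_dite {α M : Type*} [Fintype α] [AddCommMonoid M] (p : α → Prop)
    [DecidablePred p] (f : {a // p a} → M) :
    ∑ a, f a = ∑ a, if h : p a then f ⟨a, h⟩ else 0 := by
  rw [← Finset.sum_subset (Finset.subset_univ (Finset.univ.filter p)),
    Finset.sum_subtype (p := p)]
  · exact Finset.sum_congr rfl fun a _ => by rw [dif_pos a.2]
  · simp
  · intro a _ ha
    exact dif_neg fun h => ha (by simpa using h)

/-- The sum of the matrices `Λ_{i→j}` over `1 ≤ i < j ≤ n + 1` is a sum over all arcs, because the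
arcs that leave node `0` contribute nothing. -/
theorem flowMatrix_eq_sum_lambda {u v : Fin n → ℝ} (hu : ∀ i, u i ≠ 0) (w : Arc n → ℝ) :
    flowMatrix u v w = ∑ i : Fin n,
      ((∑ j : {j : Fin n // i < j}, w (arcTo i j.1 j.2) • lambdaTo u v i j.1) +
        w (arcEnd i) • lambdaEnd u v i) := by
  let F : Fin (n + 2) → Fin (n + 2) → Matrix (Fin n) (Fin n) ℝ := fun i j =>
    if h : i < j then w ⟨(i, j), h⟩ • arcMatrix u v ⟨(i, j), h⟩ else 0
  have hF : flowMatrix u v w = ∑ i, ∑ j, F i j := by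
    rw [flowMatrix_apply, ← Fintype.sum_prod_type', sum_subtype_eq_sum_dite]
  have h0 : ∀ j, F 0 j = 0 := by
    intro j
    simp only [F]
    split_ifs
    · rw [arcMatrix, if_pos rfl, smul_zero]
    · rfl
  have hlast : ∀ j, F (Fin.last (n + 1)) j = 0 := fun j => dif_neg (Fin.le_last j).not_gt
  have hto0 : ∀ i : Fin n, F (node i) 0 = 0 := fun i => dif_neg (Fin.zero_le _).not_gt
  rw [hF, Fin.sum_univ_castSucc, Fin.sum_univ_succ]
  simp only [Fin.castSucc_zero, h0, hlast, Finset.sum_const_zero, zero_add, add_zero]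
  refine Finset.sum_congr rfl fun i _ => ?_
  rw [Fin.sum_univ_castSucc, Fin.sum_univ_succ]
  change F (node i) 0 + ∑ j : Fin n, F (node i) (node j) + F (node i) (Fin.last (n + 1)) = _
  rw [hto0, zero_add]
  congr 1
  · rw [sum_subtype_eq_sum_dite]
    refine Finset.sum_congr rfl fun j _ => ?_
    by_cases h : i < j
    · rw [dif_pos h, ← arcMatrix_arcTo hu i j h]
      exact dif_pos (node_lt_node.2 h)
    · rw [dif_neg h]
      exact dif_neg fun h' => h (node_lt_node.1 h')
  · rw [← arcMatrix_arcEnd hu i]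
    exact dif_pos (arcEnd i).2

/-! ### Flows and paths -/

theorem inflow_add (p q : Arc n → ℝ) (l : Fin (n + 2)) :
    inflow (p + q) l = inflow p l + inflow q l := Finset.sum_add_distrib

theorem outflow_add (p q : Arc n → ℝ) (l : Fin (n + 2)) :
    outflow (p + q) l = outflow p l + outflow q l := Finset.sum_add_distrib

theorem inflow_smul (c : ℝ) (p : Arc n → ℝ) (l : Fin (n + 2)) :
    inflow (c • p) l = c * inflow p l := (Finset.mul_sum ..).symm

theorem outflow_smul (c : ℝ) (p : Arc n → ℝ) (l : Fin (n + 2)) :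
    outflow (c • p) l = c * outflow p l := (Finset.mul_sum ..).symm

theorem inflow_single (a : Arc n) (l : Fin (n + 2)) :
    inflow (Pi.single a 1) l = if a.1.2 = l then 1 else 0 := by
  simp [inflow, Pi.single_apply]

theorem outflow_single (a : Arc n) (l : Fin (n + 2)) :
    outflow (Pi.single a 1) l = if a.1.1 = l then 1 else 0 := by
  simp [outflow, Pi.single_apply]

/-- `IsPath l p` says that `p` is the incidence vector of a directed path from the node `l` to the
final node `n + 1`. -/
inductive IsPath : Fin (n + 2) → (Arc n → ℝ) → Prop
  | nil : IsPath (Fin.last (n + 1)) 0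
  | cons (a : Arc n) {p : Arc n → ℝ} : IsPath a.1.2 p → IsPath a.1.1 (Pi.single a 1 + p)

namespace IsPath

theorem nonneg {l : Fin (n + 2)} {p : Arc n → ℝ} (h : IsPath l p) : 0 ≤ p := by
  induction h with
  | nil => exact le_rfl
  | cons a _ ih => exact add_nonneg (Pi.single_nonneg.2 zero_le_one) ih

theorem inflow_sub_outflow {l : Fin (n + 2)} {p : Arc n → ℝ} (h : IsPath l p)
    (m : Fin (n + 2)) : inflow p m - outflow p m =
      (if m = Fin.last (n + 1) then 1 else 0) - (if m = l then 1 else 0) := by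
  induction h with
  | nil => simp [inflow, outflow]
  | cons a _ ih =>
    rw [inflow_add, outflow_add, inflow_single, outflow_single]
    simp only [eq_comm (a := m)] at ih ⊢
    linarith

theorem outflow_of_lt {l : Fin (n + 2)} {p : Arc n → ℝ} (h : IsPath l p) {m : Fin (n + 2)}
    (hm : m < l) : outflow p m = 0 := by
  induction h with
  | nil => simp [outflow]
  | cons a _ ih => rw [outflow_add, outflow_single, if_neg hm.ne', ih (hm.trans a.2), add_zero]

theorem outflow_start {l : Fin (n + 2)} {p : Arc n → ℝ} (h : IsPath l p)
    (hl : l ≠ Fin.last (n + 1)) : outflow p l = 1 := by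
  cases h with
  | nil => exact absurd rfl hl
  | cons a h => rw [outflow_add, outflow_single, if_pos rfl, h.outflow_of_lt a.2, add_zero]

theorem outflow_eq_zero_or_one {l : Fin (n + 2)} {p : Arc n → ℝ} (h : IsPath l p)
    (m : Fin (n + 2)) : outflow p m = 0 ∨ outflow p m = 1 := by
  induction h with
  | nil => simp [outflow]
  | cons a h ih =>
    rw [outflow_add, outflow_single]
    split_ifs with hm
    · subst hm
      rw [h.outflow_of_lt a.2, add_zero]
      exact Or.inr rfl
    · rwa [zero_add]

theorem apply_le_outflow {l : Fin (n + 2)} {p : Arc n → ℝ} (h : IsPath l p) (a : Arc n) :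
    p a ≤ outflow p a.1.1 :=
  Finset.single_le_sum (f := p) (fun b _ => h.nonneg b) (by simp)

theorem le_one {l : Fin (n + 2)} {p : Arc n → ℝ} (h : IsPath l p) : p ≤ 1 := by
  intro a
  have h1 := h.apply_le_outflow a
  rcases h.outflow_eq_zero_or_one a.1.1 with h2 | h2 <;> rw [h2] at h1
  · exact h1.trans zero_le_one
  · exact h1

/-- Beyond the node `l`, a path from `l` can visit any prescribed set of nodes and no others. -/
theorem exists_outflow_eq (s : Set (Fin n)) [DecidablePred (· ∈ s)] (l : Fin (n + 2)) :
    ∃ p, IsPath l p ∧ ∀ k, l < node k → outflow p (node k) = if k ∈ s then 1 else 0 := by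
  induction l using WellFoundedGT.induction with
  | ind l ih =>
    by_cases hl : l = Fin.last (n + 1)
    · subst hl
      exact ⟨0, nil, fun k hk => absurd hk (Fin.le_last _).not_gt⟩
    -- The first node beyond `l` that the path has to visit.
    obtain ⟨j, ⟨hlj, hj⟩, hmin⟩ := wellFounded_lt.has_min
      {m : Fin (n + 2) | l < m ∧ (m = Fin.last (n + 1) ∨ ∃ k ∈ s, m = node k)}
      ⟨_, Fin.lt_last_iff_ne_last.2 hl, Or.inl rfl⟩
    obtain ⟨p, hp, hps⟩ := ih j hlj
    refine ⟨_, cons ⟨(l, j), hlj⟩ hp, fun k hk => ?_⟩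
    rw [outflow_add, outflow_single, if_neg hk.ne, zero_add]
    rcases lt_trichotomy (node k) j with h | h | h
    · rw [hp.outflow_of_lt h, if_neg fun hks => hmin _ ⟨hk, Or.inr ⟨k, hks, rfl⟩⟩ h]
    · subst h
      rw [hp.outflow_start (node_ne_last k), if_pos]
      rcases hj with h | ⟨k', hk', e⟩
      · exact absurd h (node_ne_last k)
      · rwa [node_injective e]
    · exact hps k h

theorem exists_start (l : Fin (n + 2)) : ∃ p : Arc n → ℝ, IsPath l p := by
  classical
  obtain ⟨p, hp, -⟩ := exists_outflow_eq (∅ : Set (Fin n)) l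
  exact ⟨p, hp⟩

/-! ### The matrix of a path -/

/-- On the part of the path that follows `m` the sum of the matrices telescopes. -/
theorem flowMatrix_mulVec_of_le {u v : Fin n → ℝ} (hQ : (factorizable u v).PosDef)
    {l : Fin (n + 2)} {p : Arc n → ℝ} (h : IsPath l p) {m : Fin (n + 2)} (hm : m ≠ 0)
    (hml : m ≤ l) :
    flowMatrix u v p *ᵥ (factorizable u v *ᵥ nodeVec u m) = nodeVec u l := by
  induction h with
  | nil => rw [map_zero, zero_mulVec, nodeVec_last]
  | cons a _ ih =>
    rw [map_add, flowMatrix_single, add_mulVec, ih (hml.trans a.2.le),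
      arcMatrix_mulVec_of_le hQ hm hml, sub_add_cancel]

theorem flowMatrix_mulVec_nodeVec {u v : Fin n → ℝ} (hQ : (factorizable u v).PosDef)
    {l : Fin (n + 2)} {p : Arc n → ℝ} (h : IsPath l p) {m : Fin (n + 2)} (hm : m ≠ 0)
    (hv : outflow p m ≠ 0) :
    flowMatrix u v p *ᵥ (factorizable u v *ᵥ nodeVec u m) = nodeVec u m := by
  induction h with
  | nil => simp [outflow] at hv
  | cons a h ih =>
    by_cases e : a.1.1 = m
    · subst e
      exact (cons a h).flowMatrix_mulVec_of_le hQ hm le_rfl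
    · rw [outflow_add, outflow_single, if_neg e, zero_add] at hv
      rw [map_add, flowMatrix_single, add_mulVec, ih hv,
        arcMatrix_mulVec_of_ge (ne_zero_of_posDef hQ)
          (not_lt.1 fun hlt => hv (h.outflow_of_lt hlt)), zero_add]

theorem flowMatrix_mulVec_apply_eq_zero (u v : Fin n → ℝ) {l : Fin (n + 2)} {p : Arc n → ℝ}
    (h : IsPath l p) {k : Fin n} (hk : outflow p (node k) = 0) (y : Fin n → ℝ) :
    (flowMatrix u v p *ᵥ y) k = 0 := by
  induction h with
  | nil => rw [map_zero, zero_mulVec, Pi.zero_apply]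
  | cons a h ih =>
    rw [outflow_add, outflow_single] at hk
    have h0 : 0 ≤ outflow _ (node k) := Finset.sum_nonneg fun b _ => h.nonneg b
    have h1 : a.1.1 ≠ node k := by
      intro e
      rw [if_pos e] at hk
      linarith
    rw [if_neg h1, zero_add] at hk
    have h2 : a.1.2 ≠ node k := by
      intro e
      have := h.outflow_start (e ▸ node_ne_last k)
      rw [e, hk] at this
      exact zero_ne_one this
    rw [map_add, flowMatrix_single, add_mulVec, Pi.add_apply, ih hk, add_zero]
    by_cases h3 : a.1.1 = 0
    · rw [arcMatrix_mulVec_of_zero _ _ _ h3, Pi.zero_apply]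
    · rw [arcMatrix_mulVec _ _ _ h3, Pi.smul_apply, Pi.sub_apply, nodeVec, nodeVec, if_neg h1,
        if_neg h2, sub_zero, smul_zero]

/-- The matrix of a path that visits the set `S` inverts `Q` on the vectors supported on `S`; that
is, it is the inverse of the principal submatrix `Q_S`, padded with zeros. -/
theorem flowMatrix_mulVec_mulVec {u v : Fin n → ℝ} (hQ : (factorizable u v).PosDef)
    {l : Fin (n + 2)} {p : Arc n → ℝ} (h : IsPath l p) {x : Fin n → ℝ}
    (hx : ∀ k, outflow p (node k) = 0 → x k = 0) :
    flowMatrix u v p *ᵥ (factorizable u v *ᵥ x) = x := by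
  have hu := ne_zero_of_posDef hQ
  have hsum : x = ∑ k, (x k * u k) • nodeVec u (node k) := by
    ext i
    simp only [nodeVec_node, Finset.sum_apply, Pi.smul_apply, smul_eq_mul, Pi.single_apply,
      mul_ite, mul_zero, Finset.sum_ite_eq, Finset.mem_univ, if_true]
    rw [mul_assoc, mul_inv_cancel₀ (hu i), mul_one]
  conv_rhs => rw [hsum]
  conv_lhs => rw [hsum]
  rw [mulVec_sum, mulVec_sum]
  refine Finset.sum_congr rfl fun k _ => ?_
  rw [mulVec_smul, mulVec_smul]
  by_cases hk : outflow p (node k) = 0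
  · rw [hx k hk, zero_mul, zero_smul, zero_smul]
  · rw [h.flowMatrix_mulVec_nodeVec hQ (node_ne_zero k) hk]

theorem flowMatrix_quadratic {u v : Fin n → ℝ} (hQ : (factorizable u v).PosDef)
    {l : Fin (n + 2)} {p : Arc n → ℝ} (h : IsPath l p) (y : Fin n → ℝ) :
    (flowMatrix u v p *ᵥ y) ⬝ᵥ (factorizable u v *ᵥ (flowMatrix u v p *ᵥ y)) =
      y ⬝ᵥ (flowMatrix u v p *ᵥ y) := by
  rw [flowMatrix_mulVec_dotProduct, h.flowMatrix_mulVec_mulVec hQ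
    fun k hk => h.flowMatrix_mulVec_apply_eq_zero u v hk y]

end IsPath

/-! ### Decomposition of flows into paths -/

theorem single_add_mem_convexHull (a : Arc n) {x : Arc n → ℝ}
    (hx : x ∈ convexHull ℝ {p | IsPath a.1.2 p}) :
    Pi.single a 1 + x ∈ convexHull ℝ {p | IsPath a.1.1 p} := by
  have : convexHull ℝ {p | IsPath a.1.2 p} ⊆
      (fun x => Pi.single a 1 + x) ⁻¹' convexHull ℝ {p | IsPath a.1.1 p} :=
    convexHull_min (fun p hp => subset_convexHull ℝ _ (IsPath.cons a hp))
      ((convex_convexHull ℝ _).translate_preimage_right _)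
  exact this hx

/-- From nonnegative arc weights, every node `l` gets a convex combination `g l` of paths from `l`:
the expected path of a walk that leaves each node along an arc chosen with probability
proportional to its weight. -/
theorem exists_expected_path {w : Arc n → ℝ} (hw : ∀ a, 0 ≤ w a) :
    ∃ g : Fin (n + 2) → Arc n → ℝ, ∀ l, g l ∈ convexHull ℝ {p | IsPath l p} ∧
      outflow w l • g l = ∑ a : Arc n with a.1.1 = l, w a • (Pi.single a 1 + g a.1.2) := by
  let C : Fin (n + 2) → Type := fun l => {x : Arc n → ℝ // x ∈ convexHull ℝ {p | IsPath l p}}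
  have step : ∀ (l : Fin (n + 2)) (ih : ∀ m, m > l → C m), ∃ x : C l,
      outflow w l • x.1 = ∑ a : Arc n, if h : a.1.1 = l then
        w a • (Pi.single a 1 + (ih a.1.2 (h ▸ a.2)).1) else 0 := by
    intro l ih
    have hval : ∀ x : Arc n → ℝ, (∑ a : Arc n, if h : a.1.1 = l then
        w a • (Pi.single a 1 + (ih a.1.2 (h ▸ a.2)).1) else 0) =
        ∑ a : Arc n with a.1.1 = l, w a • (if h : a.1.1 = l then
          (Pi.single a 1 + (ih a.1.2 (h ▸ a.2)).1) else x) := by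
      intro x
      rw [Finset.sum_filter]
      refine Finset.sum_congr rfl fun a _ => ?_
      split_ifs <;> rfl
    obtain ⟨p, hp⟩ := IsPath.exists_start l
    rcases (show 0 ≤ outflow w l from Finset.sum_nonneg fun a _ => hw a).eq_or_lt' with h0 | h0
    · refine ⟨⟨p, subset_convexHull ℝ _ hp⟩, ?_⟩
      rw [hval p, h0, zero_smul]
      have := (Finset.sum_eq_zero_iff_of_nonneg fun a _ => hw a).1 h0
      exact (Finset.sum_eq_zero fun a ha => by rw [this a ha, zero_smul]).symm
    · refine ⟨⟨(outflow w l)⁻¹ • ∑ a : Arc n with a.1.1 = l, w a • (if h : a.1.1 = l then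
          (Pi.single a 1 + (ih a.1.2 (h ▸ a.2)).1) else p), ?_⟩, ?_⟩
      · rw [Finset.smul_sum]
        simp only [smul_smul]
        refine (convex_convexHull ℝ _).sum_mem
          (fun a _ => mul_nonneg (inv_nonneg.2 h0.le) (hw a)) ?_ fun a ha => ?_
        · rw [← Finset.mul_sum]
          exact inv_mul_cancel₀ h0.ne'
        · have ha' : a.1.1 = l := (Finset.mem_filter.1 ha).2
          subst ha'
          rw [dif_pos rfl]
          exact single_add_mem_convexHull a (ih a.1.2 a.2).2
      · rw [hval p, smul_smul, mul_inv_cancel₀ h0.ne', one_smul]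
  choose f hf using step
  let g : ∀ l, C l := IsWellFounded.fix (· > ·) f
  refine ⟨fun l => (g l).1, fun l => ⟨(g l).2, ?_⟩⟩
  have hg : g l = f l fun m _ => g m := IsWellFounded.fix_eq _ f l
  beta_reduce
  rw [hg, hf, Finset.sum_filter]
  refine Finset.sum_congr rfl fun a _ => ?_
  split_ifs <;> rfl

/-- A unit flow from node `0` to node `n + 1` is a convex combination of paths. The identities of
`exists_expected_path`, summed over all nodes, express the flow as `∑ w_a (g_i - g_j)` over the
arcs `a = (i, j)`, and flow balance reduces this sum to `g 0`. -/
theorem mem_convexHull_of_balance {w : Arc n → ℝ} (hw : ∀ a, 0 ≤ w a)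
    (hb : ∀ l : Fin (n + 2), inflow w l - outflow w l =
      if l = 0 then -1 else if l = Fin.last (n + 1) then 1 else 0) :
    w ∈ convexHull ℝ {p | IsPath 0 p} := by
  obtain ⟨g, hg⟩ := exists_expected_path hw
  have hout : ∑ a, w a • g a.1.1 = ∑ l, outflow w l • g l := by
    rw [← Finset.sum_fiberwise (s := Finset.univ) (g := fun a : Arc n => a.1.1)]
    refine Finset.sum_congr rfl fun l _ => ?_
    rw [outflow, Finset.sum_smul]
    exact Finset.sum_congr rfl fun a ha => by rw [(Finset.mem_filter.1 ha).2]
  have hin : ∑ a, w a • g a.1.2 = ∑ l, inflow w l • g l := by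
    rw [← Finset.sum_fiberwise (s := Finset.univ) (g := fun a : Arc n => a.1.2)]
    refine Finset.sum_congr rfl fun l _ => ?_
    rw [inflow, Finset.sum_smul]
    exact Finset.sum_congr rfl fun a ha => by rw [(Finset.mem_filter.1 ha).2]
  have hstep : ∑ l, outflow w l • g l = w + ∑ a, w a • g a.1.2 := by
    rw [Finset.sum_congr rfl fun l _ => (hg l).2, Finset.sum_fiberwise]
    simp only [smul_add, Finset.sum_add_distrib]
    congr 1
    ext b
    simp [Finset.sum_apply, Pi.single_apply]
  have hlast : g (Fin.last (n + 1)) = 0 := by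
    have : {p : Arc n → ℝ | IsPath (Fin.last (n + 1)) p} ⊆ {0} := by
      intro p (hp : IsPath _ p)
      refine funext fun a => le_antisymm ((hp.apply_le_outflow a).trans_eq ?_) (hp.nonneg a)
      exact hp.outflow_of_lt (a.2.trans_le (Fin.le_last _))
    exact convexHull_min this (convex_singleton 0) (hg _).1
  have hw0 : w = g 0 := by
    have h1 : w = -∑ l, (inflow w l - outflow w l) • g l := by
      simp only [sub_smul, Finset.sum_sub_distrib]
      rw [← hin, hstep]
      abel
    have h2 : ∑ l, (inflow w l - outflow w l) • g l = -g 0 := by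
      rw [Fin.sum_univ_succ, hb, if_pos rfl, neg_smul, one_smul, Finset.sum_eq_zero, add_zero]
      intro i _
      rw [hb, if_neg (Fin.succ_ne_zero i)]
      split_ifs with h
      · rw [h, hlast, smul_zero]
      · rw [zero_smul]
    rw [h1, h2, neg_neg]
  rw [hw0]
  exact (hg 0).1

/-! ### The bordered matrix -/

theorem bordered_posSemidef_iff {W : Matrix (Fin n) (Fin n) ℝ} (hW : Wᵀ = W) (x : Fin n → ℝ)
    (τ : ℝ) : (bordered W x τ).PosSemidef ↔
      ∀ (y : Fin n → ℝ) (t : ℝ), 0 ≤ y ⬝ᵥ (W *ᵥ y) + 2 * t * (x ⬝ᵥ y) + t ^ 2 * τ := by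
  have hsymm : (bordered W x τ).IsHermitian := by
    rw [IsHermitian, conjTranspose_eq_transpose_of_trivial, bordered, fromBlocks_transpose, hW]
    rfl
  have hval : ∀ q : Fin n ⊕ Unit → ℝ, star q ⬝ᵥ (bordered W x τ *ᵥ q) =
      (q ∘ Sum.inl) ⬝ᵥ (W *ᵥ (q ∘ Sum.inl)) + 2 * q (Sum.inr ()) * (x ⬝ᵥ (q ∘ Sum.inl)) +
        q (Sum.inr ()) ^ 2 * τ := by
    intro q
    have h1 : (q ∘ Sum.inl) ⬝ᵥ (replicateCol Unit x *ᵥ (q ∘ Sum.inr)) =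
        q (Sum.inr ()) * (x ⬝ᵥ (q ∘ Sum.inl)) := by
      simp only [dotProduct, mulVec, replicateCol_apply, Function.comp_apply,
        Finset.univ_unique, Finset.sum_singleton, Finset.mul_sum, PUnit.default_eq_unit]
      exact Finset.sum_congr rfl fun i _ => by ring
    rw [star_trivial, bordered, fromBlocks_mulVec]
    simp only [dotProduct, Fintype.sum_sum_type, Sum.elim_inl, Sum.elim_inr] at h1 ⊢
    simp only [Pi.add_apply, mul_add, Finset.sum_add_distrib]
    simp only [Function.comp_apply] at h1 ⊢
    rw [h1]
    simp [mulVec, dotProduct]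
    ring
  rw [posSemidef_iff_dotProduct_mulVec]
  constructor
  · rintro ⟨-, h⟩ y t
    have := h (Sum.elim y fun _ => t)
    rwa [hval] at this
  · exact fun h => ⟨hsymm, fun q => (hval q).symm ▸ h _ _⟩

/-- Nonnegativity of the bordered quadratic form forces `x` into the range of `W`: a functional
that vanishes on the range but not at `x` would make the form affine and unbounded below. -/
theorem exists_mulVec_eq_of_bordered_nonneg {W : Matrix (Fin n) (Fin n) ℝ} {x : Fin n → ℝ} {τ : ℝ}
    (h : ∀ (y : Fin n → ℝ) (t : ℝ), 0 ≤ y ⬝ᵥ (W *ᵥ y) + 2 * t * (x ⬝ᵥ y) + t ^ 2 * τ) :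
    ∃ y, W *ᵥ y = x := by
  by_contra hx
  have hx' : x ∉ LinearMap.range W.mulVecLin := fun ⟨y, hy⟩ => hx ⟨y, hy⟩
  obtain ⟨f, hf, hmap⟩ := Submodule.exists_dual_map_eq_bot_of_notMem hx' inferInstance
  have hfd : ∀ z : Fin n → ℝ, f z = (fun i => f (Pi.single i 1)) ⬝ᵥ z := by
    intro z
    conv_lhs => rw [pi_eq_sum_univ' z]
    simp [dotProduct, mul_comm]
  set d : Fin n → ℝ := fun i => f (Pi.single i 1)
  have hWd : ∀ y, d ⬝ᵥ (W *ᵥ y) = 0 := by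
    intro y
    rw [← hfd]
    have : f (W.mulVecLin y) ∈ (LinearMap.range W.mulVecLin).map f :=
      Submodule.mem_map_of_mem ⟨y, rfl⟩
    rw [hmap] at this
    exact this
  have hxd : x ⬝ᵥ d ≠ 0 := by
    rw [dotProduct_comm, ← hfd]
    exact hf
  have key := h ((-(τ + 1) / (2 * (x ⬝ᵥ d))) • d) 1
  rw [mulVec_smul, dotProduct_smul, smul_dotProduct, hWd, dotProduct_smul] at key
  simp only [smul_eq_mul] at key
  have : 2 * 1 * (-(τ + 1) / (2 * (x ⬝ᵥ d)) * (x ⬝ᵥ d)) = -(τ + 1) := by field_simp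
  rw [mul_zero, mul_zero, this] at key
  linarith

/-! ### Unit flows and the extended formulation -/

/-- The unit flows from node `0` to node `n + 1`. -/
def unitFlows (n : ℕ) : Set (Arc n → ℝ) :=
  {w | (∀ a, 0 ≤ w a) ∧ ∀ l : Fin (n + 2), inflow w l - outflow w l =
    if l = 0 then -1 else if l = Fin.last (n + 1) then 1 else 0}

theorem IsPath.mem_unitFlows {p : Arc n → ℝ} (h : IsPath 0 p) : p ∈ unitFlows n := by
  refine ⟨h.nonneg, fun l => ?_⟩
  rw [h.inflow_sub_outflow]
  by_cases h0 : l = 0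
  · subst h0
    simp [Fin.ext_iff]
  · simp [h0]

theorem IsPath.inflow_node {p : Arc n → ℝ} (h : IsPath 0 p) (i : Fin n) :
    inflow p (node i) = outflow p (node i) := by
  have := h.inflow_sub_outflow (node i)
  rw [if_neg (node_ne_last i), if_neg (node_ne_zero i)] at this
  linarith

theorem continuous_inflow (l : Fin (n + 2)) : Continuous fun w : Arc n → ℝ => inflow w l :=
  continuous_finsetSum _ fun a _ => continuous_apply a

theorem continuous_outflow (l : Fin (n + 2)) : Continuous fun w : Arc n → ℝ => outflow w l :=
  continuous_finsetSum _ fun a _ => continuous_apply a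

theorem isCompact_unitFlows : IsCompact (unitFlows n) := by
  refine (isCompact_Icc (a := (0 : Arc n → ℝ)) (b := 1)).of_isClosed_subset ?_ fun w hw => ?_
  · rw [unitFlows, Set.ofPred_and]
    simp only [Set.ofPred_forall]
    exact (isClosed_iInter fun a => isClosed_le continuous_const (continuous_apply a)).inter
      (isClosed_iInter fun l =>
        isClosed_eq ((continuous_inflow l).sub (continuous_outflow l)) continuous_const)
  · have hsub : {p : Arc n → ℝ | IsPath 0 p} ⊆ Set.Icc 0 1 := fun p (hp : IsPath 0 p) =>
      ⟨hp.nonneg, hp.le_one⟩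
    exact convexHull_min hsub (convex_Icc 0 1) (mem_convexHull_of_balance hw.1 hw.2)

/-- The set described by the path constraints and the semidefinite constraint, with `W` eliminated
and the semidefinite constraint in the form of a family of inequalities linear in `(x, τ, w)`. -/
def flowHull (u v : Fin n → ℝ) : Set (Point n) :=
  {q | ∃ w ∈ unitFlows n, (∀ i, q.2.1 i = inflow w (node i)) ∧ ∀ (y : Fin n → ℝ) (t : ℝ),
    0 ≤ y ⬝ᵥ (flowMatrix u v w *ᵥ y) + 2 * t * (q.1 ⬝ᵥ y) + t ^ 2 * q.2.2}

theorem mem_flowHull_iff {u v : Fin n → ℝ} (hu : ∀ i, u i ≠ 0) (q : Point n) :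
    q ∈ flowHull u v ↔ ∃ (W : Matrix (Fin n) (Fin n) ℝ) (w : Arc n → ℝ),
      (bordered W q.1 q.2.2).PosSemidef ∧ PathConstraints u v q.2.1 w W := by
  constructor
  · rintro ⟨w, hw, hz, h⟩
    exact ⟨flowMatrix u v w, w, (bordered_posSemidef_iff (flowMatrix_transpose u v w) _ _).2 h,
      hw.1, hw.2, hz, flowMatrix_eq_sum_lambda hu w⟩
  · rintro ⟨W, w, h, hw, hb, hz, hW⟩
    rw [← flowMatrix_eq_sum_lambda hu] at hW
    subst hW
    exact ⟨w, ⟨hw, hb⟩, hz, (bordered_posSemidef_iff (flowMatrix_transpose u v w) _ _).1 h⟩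

theorem convex_flowHull (u v : Fin n → ℝ) : Convex ℝ (flowHull u v) := by
  rintro q ⟨w, hw, hz, h⟩ q' ⟨w', hw', hz', h'⟩ a b ha hb hab
  refine ⟨a • w + b • w', ⟨fun e => ?_, fun l => ?_⟩, fun i => ?_, fun y t => ?_⟩
  · exact add_nonneg (mul_nonneg ha (hw.1 e)) (mul_nonneg hb (hw'.1 e))
  · rw [inflow_add, outflow_add, inflow_smul, inflow_smul, outflow_smul, outflow_smul]
    linear_combination a * hw.2 l + b * hw'.2 l +
      (if l = 0 then -1 else if l = Fin.last (n + 1) then 1 else 0) * hab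
  · rw [inflow_add, inflow_smul, inflow_smul, ← hz, ← hz']
    rfl
  · have h1 := add_nonneg (mul_nonneg ha (h y t)) (mul_nonneg hb (h' y t))
    refine h1.trans_eq ?_
    rw [map_add, map_smul, map_smul, add_mulVec, dotProduct_add, smul_mulVec, smul_mulVec,
      dotProduct_smul, dotProduct_smul]
    simp only [Prod.fst_add, Prod.snd_add, Prod.smul_fst, Prod.smul_snd, add_dotProduct,
      smul_dotProduct, smul_eq_mul]
    ring

theorem isClosed_flowHull (u v : Fin n → ℝ) : IsClosed (flowHull u v) := by
  have : CompactSpace (unitFlows n) := isCompact_iff_compactSpace.1 isCompact_unitFlows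
  let K : Set (Point n × unitFlows n) :=
    {r | (∀ i, r.1.2.1 i = inflow r.2.1 (node i)) ∧ ∀ (y : Fin n → ℝ) (t : ℝ),
      0 ≤ y ⬝ᵥ (flowMatrix u v r.2.1 *ᵥ y) + 2 * t * (r.1.1 ⬝ᵥ y) + t ^ 2 * r.1.2.2}
  have hK : IsClosed K := by
    simp only [K, Set.ofPred_and, Set.ofPred_forall]
    refine (isClosed_iInter fun i => isClosed_eq (by fun_prop) ?_).inter
      (isClosed_iInter fun y => isClosed_iInter fun t => isClosed_le continuous_const ?_)
    · exact (continuous_inflow _).comp (by fun_prop)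
    · have : Continuous (flowMatrix u v) := (flowMatrix u v).continuous_of_finiteDimensional
      have : Continuous fun r : Point n × unitFlows n => flowMatrix u v r.2.1 :=
        this.comp (by fun_prop)
      simp only [dotProduct, mulVec]
      fun_prop
  have himg : flowHull u v = Prod.fst '' K := by
    ext q
    constructor
    · rintro ⟨w, hw, h⟩
      exact ⟨(q, ⟨w, hw⟩), h, rfl⟩
    · rintro ⟨⟨q, w, hw⟩, h, rfl⟩
      exact ⟨w, hw, h⟩
  rw [himg]
  exact isClosedMap_fst_of_compactSpace _ hK

/-- A point with binary `z` is feasible along the path that visits the support of `z`. -/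
theorem epigraphSet_subset_flowHull {u v : Fin n → ℝ} (hQ : (factorizable u v).PosDef) :
    epigraphSet (factorizable u v) ⊆ flowHull u v := by
  classical
  rintro ⟨x, z, τ⟩ ⟨hz, -, hτ, hx⟩
  dsimp only at hz hτ hx
  obtain ⟨p, hp, hps⟩ := IsPath.exists_outflow_eq {i | z i = 1} (0 : Fin (n + 2))
  have hpz : ∀ i, z i = outflow p (node i) := by
    intro i
    rw [hps i (Fin.pos_iff_ne_zero.2 (node_ne_zero i))]
    rcases hz i with h | h <;> simp [h]
  refine ⟨p, hp.mem_unitFlows, fun i => (hpz i).trans (hp.inflow_node i).symm, fun y t => ?_⟩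
  have hWx : flowMatrix u v p *ᵥ (factorizable u v *ᵥ x) = x := by
    refine hp.flowMatrix_mulVec_mulVec hQ fun k hk => ?_
    have := hx k
    rwa [hpz k, hk, sub_zero, mul_one] at this
  -- Complete the square: evaluate the form of `W` at `y + t Q x`, where `W Q x = x`.
  have h1 := flowMatrix_nonneg hQ hp.nonneg (y + t • (factorizable u v *ᵥ x))
  have h2 : (factorizable u v *ᵥ x) ⬝ᵥ (flowMatrix u v p *ᵥ y) = x ⬝ᵥ y := by
    rw [← flowMatrix_mulVec_dotProduct, hWx]
  rw [mulVec_add, mulVec_smul, hWx, dotProduct_add, add_dotProduct, add_dotProduct,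
    smul_dotProduct, smul_dotProduct, dotProduct_smul, dotProduct_smul, h2, dotProduct_comm y x,
    dotProduct_comm _ x] at h1
  simp only [smul_eq_mul] at h1
  dsimp only
  nlinarith [mul_le_mul_of_nonneg_left hτ (sq_nonneg t)]

/-- Given `x = W y`, splitting the flow into paths splits `(x, z, yᵀ W y)` into points of the
epigraph, one for each path. -/
theorem flowHull_subset_convexHull {u v : Fin n → ℝ} (hQ : (factorizable u v).PosDef) :
    flowHull u v ⊆ convexHull ℝ (epigraphSet (factorizable u v)) := by
  rintro ⟨x, z, τ⟩ ⟨w, hw, hz, h⟩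
  dsimp only at hz h
  obtain ⟨y, rfl⟩ := exists_mulVec_eq_of_bordered_nonneg h
  have hτ : 0 ≤ τ - y ⬝ᵥ (flowMatrix u v w *ᵥ y) := by
    have := h y (-1)
    rw [dotProduct_comm _ y] at this
    linarith
  let L : (Arc n → ℝ) →ₗ[ℝ] Point n :=
    { toFun := fun p => (flowMatrix u v p *ᵥ y, fun i => inflow p (node i),
        y ⬝ᵥ (flowMatrix u v p *ᵥ y))
      map_add' := fun p q => by
        simp only [map_add, add_mulVec, dotProduct_add, inflow_add]
        rfl
      map_smul' := fun c p => by
        simp only [map_smul, smul_mulVec, dotProduct_smul, inflow_smul]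
        rfl }
  -- The surplus of `τ` over `yᵀ W y` goes to the point of every path alike.
  let s : Point n := (0, 0, τ - y ⬝ᵥ (flowMatrix u v w *ᵥ y))
  have hsub : {p : Arc n → ℝ | IsPath 0 p} ⊆
      L ⁻¹' ((fun q => q + s) ⁻¹' convexHull ℝ (epigraphSet (factorizable u v))) := by
    intro p (hp : IsPath 0 p)
    refine subset_convexHull ℝ _ ⟨fun i => ?_, ?_, ?_, fun i => ?_⟩
    · change inflow p (node i) + 0 = 0 ∨ inflow p (node i) + 0 = 1
      rw [add_zero, hp.inflow_node]
      exact hp.outflow_eq_zero_or_one _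
    · exact add_nonneg (flowMatrix_nonneg hQ hp.nonneg y) hτ
    · change (flowMatrix u v p *ᵥ y + 0) ⬝ᵥ (factorizable u v *ᵥ (flowMatrix u v p *ᵥ y + 0)) ≤
        y ⬝ᵥ (flowMatrix u v p *ᵥ y) + (τ - y ⬝ᵥ (flowMatrix u v w *ᵥ y))
      rw [add_zero, hp.flowMatrix_quadratic hQ]
      linarith
    · change ((flowMatrix u v p *ᵥ y) i + 0) * (1 - (inflow p (node i) + 0)) = 0
      rw [add_zero, add_zero, hp.inflow_node]
      rcases hp.outflow_eq_zero_or_one (node i) with h0 | h0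
      · rw [hp.flowMatrix_mulVec_apply_eq_zero u v h0, zero_mul]
      · rw [h0, sub_self, mul_zero]
  have hmem := convexHull_min hsub
    (((convex_convexHull ℝ _).translate_preimage_left s).linear_preimage L)
    (mem_convexHull_of_balance hw.1 hw.2)
  have heq : L w + s = (flowMatrix u v w *ᵥ y, z, τ) := by
    refine Prod.ext (add_zero _) (Prod.ext ?_ (add_sub_cancel _ _))
    funext i
    exact (add_zero _).trans (hz i).symm
  rw [← heq]
  exact hmem

end FactorizableHull

theorem mainTheorem2 (n : ℕ) (u v : Fin n → ℝ)
    (hQ : (FactorizableHull.factorizable u v).PosDef) :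
    closure (convexHull ℝ
        (FactorizableHull.epigraphSet (FactorizableHull.factorizable u v))) =
      {p : FactorizableHull.Point n |
        ∃ (W : Matrix (Fin n) (Fin n) ℝ) (w : FactorizableHull.Arc n → ℝ),
          (FactorizableHull.bordered W p.1 p.2.2).PosSemidef ∧
          FactorizableHull.PathConstraints u v p.2.1 w W} := by
  have hset := Set.ext (FactorizableHull.mem_flowHull_iff (v := v)
    (FactorizableHull.ne_zero_of_posDef hQ))
  refine Eq.trans ?_ hset
  refine Set.Subset.antisymm ?_
    ((FactorizableHull.flowHull_subset_convexHull hQ).trans subset_closure)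
  exact closure_minimal (convexHull_min (FactorizableHull.epigraphSet_subset_flowHull hQ)
    (FactorizableHull.convex_flowHull u v)) (FactorizableHull.isClosed_flowHull u v)
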